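/- Let $\mathscr{A}$ be a simple C*-algebra, unital or not (its only closed two-sided ideals are $0$ and $\mathscr{A}\neq 0$), and suppose that $\mathscr{A}$ is infinite, i.e. contains an infinite projection. Here projections $p,q\in\mathscr{A}$ are equivalent, $p\sim q$, if $p=v^*v$ and $q=vv^*$ for some $v\in\mathscr{A}$, and a projection is infinite if it is equivalent to a proper subprojection of itself. The group $K_0(\mathscr{A})$ is taken in Cuntz's description for infinite simple C*-algebras: its elements are the equivalence classes $[p]$ of infinite projections $p\in\mathscr{A}$, with $[p]+[q]=[p'+q']$ whenever $p'\sim p$, $q'\sim q$ and $p'q'=0$, and its zero element is $[r-r']$ for any projections $r'<r$ in $\mathscr{A}$ with $r'\sim r$ and $r-r'$ infinite. A projection $p$ represents the zero element if $p$ is infinite and $[p]=0$ in $K_0(\mathscr{A})$. (i) If $p,q\in\mathscr{A}$ are orthogonal equivalent projections that both represent the zero element of $K_0(\mathscr{A})$, then for all real numbers $\alpha>1$ and $\beta\ge 0$ the element $\alpha p+\beta q$ is a finite sum of projections of $\mathscr{A}$. (ii) If $p\in\mathscr{A}$ is a projection that represents the zero element of $K_0(\mathscr{A})$, then for every real number $\alpha>1$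 the element $\alpha p$ is a finite sum of projections of $\mathscr{A}$. -/

import Mathlib

namespace CStarK0

variable {A : Type*} [NonUnitalCStarAlgebra A]

/-- Murray–von Neumann equivalence `p ∼ q` (used for projections only):
`p = v* v` and `q = v v*` for some `v ∈ A`. -/
def MvNEquiv (p q : A) : Prop :=
  ∃ v : A, star v * v = p ∧ v * star v = q

/-- `p'` and `p` are projections with `p' ≤ p` (that is, `p p' = p'`) and `p' ≠ p`. -/
structure IsProperSubprojection (p' p : A) : Prop where
  left : IsStarProjection p'
  right : IsStarProjection p
  mul_eq : p * p' = p'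
  ne : p' ≠ p

/-- A projection is infinite if it is equivalent to a proper subprojection of itself. -/
def IsInfiniteProjection (p : A) : Prop :=
  IsStarProjection p ∧ ∃ p' : A, IsProperSubprojection p' p ∧ MvNEquiv p' p

variable (A) in
/-- A simple C*-algebra: a nonzero algebra whose only closed two-sided ideals are `0` and `A`. -/
def IsSimpleCStar : Prop :=
  Nontrivial A ∧ ∀ I : Submodule ℂ A, IsClosed (I : Set A) →
    (∀ a : A, ∀ x ∈ I, a * x ∈ I ∧ x * a ∈ I) → I = ⊥ ∨ I = ⊤

variable (A) in
/-- An infinite (simple) C*-algebra: one that contains an infinite projection. -/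
def IsInfiniteCStar : Prop :=
  ∃ p : A, IsInfiniteProjection p

theorem MvNEquiv.symm {p q : A} (h : MvNEquiv p q) : MvNEquiv q p := by
  obtain ⟨v, h1, h2⟩ := h
  exact ⟨star v, by simpa using h2, by simpa using h1⟩

theorem MvNEquiv.refl {p : A} (hp : IsStarProjection p) : MvNEquiv p p := by
  have h1 : star p = p := hp.isSelfAdjoint
  have h2 : p * p = p := hp.isIdempotentElem
  exact ⟨p, by rw [h1, h2], by rw [h1, h2]⟩

theorem MvNEquiv.trans {p q r : A} (hp : IsStarProjection p) (hr : IsStarProjection r)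
    (h : MvNEquiv p q) (h' : MvNEquiv q r) : MvNEquiv p r := by
  obtain ⟨v, h1, h2⟩ := h
  obtain ⟨w, h3, h4⟩ := h'
  have hp2 : p * p = p := hp.isIdempotentElem
  have hr2 : r * r = r := hr.isIdempotentElem
  refine ⟨w * v, ?_, ?_⟩
  · calc star (w * v) * (w * v) = star v * (star w * w) * v := by
          simp only [star_mul, mul_assoc]
      _ = (star v * v) * (star v * v) := by rw [h3, ← h2]; simp only [mul_assoc]
      _ = p := by rw [h1, hp2]
  · calc (w * v) * star (w * v) = w * (v * star v) * star w := by
          simp only [star_mul, mul_assoc]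
      _ = (w * star w) * (w * star w) := by rw [h2, ← h3]; simp only [mul_assoc]
      _ = r := by rw [h4, hr2]

variable (A) in
/-- Murray–von Neumann equivalence as an equivalence relation on the infinite projections. -/
def infiniteProjectionSetoid : Setoid {p : A // IsInfiniteProjection p} where
  r p q := MvNEquiv p.1 q.1
  iseqv :=
    { refl := fun p => MvNEquiv.refl p.2.1
      symm := fun h => h.symm
      trans := fun {p _ r} h h' => MvNEquiv.trans p.2.1 r.2.1 h h' }

variable (A) in
/-- The (underlying set of the) group `K₀(A)` of an infinite simple C*-algebra `A` in Cuntz's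
description: the set of Murray–von Neumann classes `[p]` of the infinite projections `p` of `A`.
(Its addition is `[p] + [q] = [p' + q']` for `p' ∼ p`, `q' ∼ q`, `p' q' = 0`.) -/
def K0 : Type _ := Quotient (infiniteProjectionSetoid A)

/-- The class `[p]` in `K₀(A)` of an infinite projection `p`. -/
def K0.mk (p : A) (hp : IsInfiniteProjection p) : K0 A :=
  Quotient.mk (infiniteProjectionSetoid A) ⟨p, hp⟩

/-- `x` is the zero element of `K₀(A)`: `x = [r - r']` for projections `r' < r` with `r' ∼ r` and
`r - r'` infinite. (As `r = r' + (r - r')`, this says `[r] + x = [r]`.) -/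
def K0.IsZero (x : K0 A) : Prop :=
  ∃ r r' : A, IsProperSubprojection r' r ∧ MvNEquiv r' r ∧
    ∃ h : IsInfiniteProjection (r - r'), x = K0.mk (r - r') h

/-- The projection `p` represents the zero element of `K₀(A)`: it is an infinite projection
whose class `[p] ∈ K₀(A)` is zero. -/
def RepresentsZero (p : A) : Prop :=
  ∃ hp : IsInfiniteProjection p, (K0.mk p hp).IsZero

/-- `a` is a finite sum of projections of `A`. -/
def IsFiniteSumOfProjections (a : A) : Prop :=
  ∃ (n : ℕ) (e : Fin n → A), (∀ i, IsStarProjection (e i)) ∧ a = ∑ i, e i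

end CStarK0

/-! A projection `p` of class zero is the sum of two orthogonal copies of itself. It is equivalent
to some `r - r'` with `r' ∼ r`; simplicity makes `r - r'` properly infinite, so `r` embeds below it,
and exchanging the embedded `r` for `r'` frees a second copy of `r - r'`. Hence `p` splits into any
positive number of copies of itself, and finite combinations of such copies behave like scalar
matrices.

For matrices, a nonnegative diagonal with integral trace `N`, at least its size, is a sum of `N`
rank-one projections (a Fourier average). Splitting a copy repeats its weight at will, so only the
total weight has to be made integral. For `α = 1 + ε`, two rank-one projections at an angle with
cosine `c` are removed from a block `diag(α, α)`, leaving the eigenvalues `ε + c` and `ε - c`.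
Unequal multiplicities let `c` tune the trace continuously, and repeating the spare weight `α > 1`
pushes the trace above the size. -/

namespace CStarK0

/-! ### Simplicity: projections as sums of conjugates of a nonzero projection -/

section Unital

variable {B : Type*} [CStarAlgebra B] [PartialOrder B] [StarOrderedRing B]

/-- If `z` lives in the corner of a projection `e` and dominates it, then `z` is conjugate to `e`
in the sense that `w* z w = e` for some `w`. -/
theorem exists_conjugate_eq_of_projection_le {e z : B} (he : IsStarProjection e)
    (hez : e * z = z) (hze : z * e = z) (h : e ≤ z) : ∃ w : B, star w * z * w = e := by
  have he2 : e * e = e := he.isIdempotentElem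
  have hes : star e = e := he.isSelfAdjoint
  -- Adding the complementary unit makes `z` invertible without leaving the commutant of `e`, so `g
  -- ^ (-1/2)` inverts `z` inside the corner.
  set g := z + (1 - e) with hg
  have hg1 : 1 ≤ g := by
    rw [hg]
    calc (1 : B) = e + (1 - e) := by abel
      _ ≤ z + (1 - e) := by gcongr
  have hgp : IsStrictlyPositive g := IsStrictlyPositive.of_le isStrictlyPositive_one hg1
  have hcomm : Commute g e := by
    simp only [hg, Commute, SemiconjBy, add_mul, mul_add, sub_mul, mul_sub, hez, hze, he2]
    simp
  have hw := CFC.conjugate_rpow_neg_one_half g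
  set w := g ^ (-(1 / 2) : ℝ) with hwdef
  have hwe : Commute w e := by
    rw [hwdef, CFC.rpow_def]
    exact hcomm.cfc_nnreal _
  have hws : star w = w := (IsSelfAdjoint.of_nonneg CFC.rpow_nonneg)
  have hzg : z = g * e := by
    rw [hg]; simp [add_mul, sub_mul, hze, he2]
  refine ⟨w * e, ?_⟩
  calc star (w * e) * z * (w * e) = e * w * (g * e) * (w * e) := by
        rw [star_mul, hws, hes, hzg]
    _ = e * (w * g * (e * w) * e) := by simp only [mul_assoc]
    _ = e * (w * g * w) * (e * e) := by rw [← hwe.eq]; simp only [mul_assoc]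
    _ = e := by rw [hw, he2, mul_one, he2]

end Unital

variable {A : Type*} [NonUnitalCStarAlgebra A]

theorem mem_topologicalClosure_span_of_isSimpleCStar (hA : IsSimpleCStar A) {d : A}
    (hd : IsStarProjection d) (hd0 : d ≠ 0) (e : A) :
    e ∈ (Submodule.span ℂ {y : A | ∃ a b, y = a * d * b}).topologicalClosure := by
  set S := Submodule.span ℂ {y : A | ∃ a b, y = a * d * b}
  have hdd : d * d = d := hd.isIdempotentElem
  have hS : ∀ a : A, ∀ x ∈ S, a * x ∈ S ∧ x * a ∈ S := by
    intro a x hx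
    induction hx using Submodule.span_induction with
    | mem x hx =>
      obtain ⟨b, c, rfl⟩ := hx
      exact ⟨Submodule.subset_span ⟨a * b, c, by simp only [mul_assoc]⟩,
        Submodule.subset_span ⟨b, c * a, by simp only [mul_assoc]⟩⟩
    | zero => simp
    | add x y _ _ hx hy =>
      rw [mul_add, add_mul]
      exact ⟨S.add_mem hx.1 hy.1, S.add_mem hx.2 hy.2⟩
    | smul c x _ hx =>
      rw [mul_smul_comm, smul_mul_assoc]
      exact ⟨S.smul_mem c hx.1, S.smul_mem c hx.2⟩
  have hI : ∀ a : A, ∀ x ∈ S.topologicalClosure,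
      a * x ∈ S.topologicalClosure ∧ x * a ∈ S.topologicalClosure := fun a x hx =>
    ⟨map_mem_closure (f := fun x => a * x) (by fun_prop) hx fun y hy => (hS a y hy).1,
      map_mem_closure (f := fun x => x * a) (by fun_prop) hx fun y hy => (hS a y hy).2⟩
  rcases hA.2 _ S.isClosed_topologicalClosure hI with h | h
  · refine absurd ?_ hd0
    have : d ∈ S.topologicalClosure :=
      S.le_topologicalClosure (Submodule.subset_span ⟨d, d, by rw [hdd, hdd]⟩)
    rwa [h, Submodule.mem_bot] at this
  · rw [h]; trivial

/-- In a simple C*-algebra every projection is a finite sum `∑ xᵢ* d xᵢ`, for any nonzero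
projection `d`. -/
theorem exists_eq_sum_conjugate (hA : IsSimpleCStar A) {d e : A}
    (hd : IsStarProjection d) (hd0 : d ≠ 0) (he : IsStarProjection e) :
    ∃ (n : ℕ) (x : Fin n → A), e = ∑ i, star (x i) * d * x i := by
  let _ : PartialOrder (Unitization ℂ A) := CStarAlgebra.spectralOrder _
  have : StarOrderedRing (Unitization ℂ A) := CStarAlgebra.spectralOrderedRing _
  have hds : star d = d := hd.isSelfAdjoint
  have hdd : d * d = d := hd.isIdempotentElem
  have hes : star e = e := he.isSelfAdjoint
  have hee : e * e = e := he.isIdempotentElem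
  obtain ⟨y, hyS, hye⟩ := Metric.mem_closure_iff.1
    (mem_topologicalClosure_span_of_isSimpleCStar hA hd hd0 e) (1 / 2) (by norm_num)
  obtain ⟨n, c, f, hy⟩ := Submodule.mem_span_set'.1 hyS
  choose a b hab using fun i => (f i).2
  have hy' : y = ∑ i, (c i • a i) * d * b i := by
    rw [← hy]
    exact Finset.sum_congr rfl fun i _ => by rw [hab, smul_mul_assoc, smul_mul_assoc]
  -- Polarization: the terms `a d b` and their adjoints are dominated by the squares `a d a*` and
  -- `b* d b`, whence twice as many conjugators.
  set x : Fin (n + n) → A := Fin.append (fun i => star (c i • a i) * e) (fun i => b i * e) with hx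
  set z : A := ∑ i, star (x i) * d * x i with hz
  have hxe : ∀ i, x i * e = x i := by
    intro i
    refine Fin.addCases (fun i => ?_) (fun i => ?_) i <;>
      simp only [hx, Fin.append_left, Fin.append_right, mul_assoc, hee]
  have hex : ∀ i, e * star (x i) = star (x i) := fun i => by
    conv_rhs => rw [← hxe i, star_mul, hes]
  have hzy : z - (e * y * e + star (e * y * e)) =
      ∑ i, star (d * (star (c i • a i) * e - b i * e)) * (d * (star (c i • a i) * e - b i * e)) := by
    rw [hz, Fin.sum_univ_add, hy', Finset.mul_sum, Finset.sum_mul, star_sum,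
      ← Finset.sum_add_distrib, ← Finset.sum_add_distrib, ← Finset.sum_sub_distrib]
    refine Finset.sum_congr rfl fun i _ => ?_
    have h : ∀ u : A, d * (d * u) = d * u := fun u => by rw [← mul_assoc, hdd]
    simp only [hx, Fin.append_left, Fin.append_right, star_mul, star_sub, star_star, hes, hds,
      sub_mul, mul_sub, mul_assoc, h]
    abel
  have hk : ‖e * (y - e) * e‖ ≤ 1 / 2 := by
    have h1 : ‖e‖ ≤ 1 := he.norm_le
    have h2 : ‖y - e‖ ≤ 1 / 2 := by rw [← dist_eq_norm, dist_comm]; exact hye.le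
    calc ‖e * (y - e) * e‖ ≤ ‖e‖ * ‖y - e‖ * ‖e‖ :=
          (norm_mul_le _ _).trans (by gcongr; exact norm_mul_le _ _)
      _ ≤ 1 * (1 / 2) * 1 := by gcongr
      _ = 1 / 2 := by norm_num
  set k := e * (y - e) * e with hkdef
  have hek : e * k * e = k := by simp only [hkdef, mul_assoc, hee]; simp only [← mul_assoc, hee]
  set ι : A → Unitization ℂ A := fun a => (a : Unitization ℂ A) with hι
  have hιmul : ∀ a b, ι (a * b) = ι a * ι b := fun a b => Unitization.inr_mul _ a b
  have hιstar : ∀ a, ι (star a) = star (ι a) := fun a => Unitization.inr_star a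
  have hιadd : ∀ a b, ι (a + b) = ι a + ι b := fun a b => Unitization.inr_add _ a b
  have hιsum : ∀ {m : ℕ} (u : Fin m → A), ι (∑ i, u i) = ∑ i, ι (u i) := fun u =>
    map_sum (Unitization.inrNonUnitalAlgHom ℂ A) u _
  have hEE : ι e * ι e = ι e := by rw [← hιmul, hee]
  have hES : star (ι e) = ι e := by rw [← hιstar, hes]
  have hpos : -(ι e) ≤ ι k + ι (star k) := by
    have hsa : IsSelfAdjoint (ι (k + star k)) := by
      rw [IsSelfAdjoint, ← hιstar]; simp [add_comm]
    have hn : ‖ι (k + star k)‖ ≤ 1 := by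
      rw [hι, Unitization.norm_inr]
      calc ‖k + star k‖ ≤ ‖k‖ + ‖star k‖ := norm_add_le _ _
        _ ≤ 1 / 2 + 1 / 2 := by rw [norm_star]; gcongr
        _ = 1 := by norm_num
    have h1 : -(1 : Unitization ℂ A) ≤ ι (k + star k) := by
      refine le_trans ?_ hsa.neg_algebraMap_norm_le_self
      rw [neg_le_neg_iff, ← map_one (algebraMap ℝ (Unitization ℂ A))]
      exact algebraMap_mono _ hn
    have h2 := star_left_conjugate_le_conjugate h1 (ι e)
    rw [hES, ← hιmul, ← hιmul, mul_add, add_mul, hek] at h2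
    have h3 : e * star k * e = star k := by
      conv_rhs => rw [← hek]
      simp only [star_mul, hes, mul_assoc]
    rw [h3, hιadd] at h2
    simpa [hEE] using h2
  have hle : ι e ≤ ι z := by
    -- The real part of `y` contributes `2e`; the tolerance `1 / 2` limits the loss from `k + star
    -- k` to one `e`.
    have hdecomp : z = (z - (e * y * e + star (e * y * e))) + (k + star k) + e + e := by
      simp only [hkdef, mul_sub, sub_mul, hee, star_sub, hes]
      abel
    have h0 : 0 ≤ ι (z - (e * y * e + star (e * y * e))) := by
      rw [hzy, hιsum]
      exact Finset.sum_nonneg fun i _ => by rw [hιmul, hιstar]; exact star_mul_self_nonneg _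
    rw [hdecomp]
    simp only [hιadd] at h0 ⊢
    calc ι e = 0 + -(ι e) + ι e + ι e := by abel
      _ ≤ _ := by gcongr
  have heze : e * z = z := by
    rw [hz, Finset.mul_sum]
    exact Finset.sum_congr rfl fun i _ => by rw [← mul_assoc, ← mul_assoc, hex]
  have hzee : z * e = z := by
    rw [hz, Finset.sum_mul]
    exact Finset.sum_congr rfl fun i _ => by rw [mul_assoc, hxe]
  obtain ⟨w, hw⟩ := exists_conjugate_eq_of_projection_le (e := ι e) (z := ι z)
    ⟨hEE, hES⟩ (by rw [← hιmul, heze]) (by rw [← hιmul, hzee]) hle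
  -- `A` is an ideal of its unitization, so `x i * w` lies in `A` although `w` need not.
  refine ⟨n + n, fun i => (ι (x i) * w).snd, ?_⟩
  have hX : ∀ i, ι ((ι (x i) * w).snd) = ι (x i) * w := fun i => by
    ext <;> simp [hι]
  refine Unitization.inr_injective (R := ℂ) ?_
  change ι e = ι _
  rw [hιsum, ← hw, hz, hιsum, Finset.mul_sum, Finset.sum_mul]
  refine Finset.sum_congr rfl fun i _ => ?_
  simp only [hιmul, hιstar, hX, star_mul, mul_assoc]

/-! ### Proper infiniteness of infinite projections -/

/-- Partial isometries `s i` with initial projection `p` and mutually orthogonal ranges. -/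
def IsIsometryFamily {ι : Type*} [DecidableEq ι] (p : A) (s : ι → A) : Prop :=
  ∀ i j, star (s i) * s j = if i = j then p else 0

/-- If `v* v` is a projection `p` then `v p = v`. -/
theorem mul_eq_self_of_star_mul_self {p v : A} (hp : IsStarProjection p) (hv : star v * v = p) :
    v * p = v := by
  have hs : star p = p := hp.isSelfAdjoint
  have h2 : p * p = p := hp.isIdempotentElem
  rw [← sub_eq_zero, ← CStarRing.star_mul_self_eq_zero_iff]
  have h3 : star v * (v * p) = p := by rw [← mul_assoc, hv, h2]
  simp only [star_sub, star_mul, hs, sub_mul, mul_sub, mul_assoc, hv, h3, h2]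
  simp

theorem isStarProjection_mul_star {p v : A} (hp : IsStarProjection p) (hv : star v * v = p) :
    IsStarProjection (v * star v) := by
  refine ⟨?_, by simp [IsSelfAdjoint]⟩
  calc v * star v * (v * star v) = v * (star v * v) * star v := by simp only [mul_assoc]
    _ = v * star v := by rw [hv, mul_eq_self_of_star_mul_self hp hv]

theorem IsProperSubprojection.isStarProjection_sub {p' p : A} (h : IsProperSubprojection p' p) :
    IsStarProjection (p - p') := by
  have h1 : star p' = p' := h.left.isSelfAdjoint
  have h2 : star p = p := h.right.isSelfAdjoint
  have h3 : p' * p' = p' := h.left.isIdempotentElem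
  have h4 : p * p = p := h.right.isIdempotentElem
  have h5 : p' * p = p' := by simpa [h1, h2] using congrArg star h.mul_eq
  refine ⟨?_, ?_⟩
  · simp only [IsIdempotentElem, sub_mul, mul_sub, h3, h4, h5, h.mul_eq]; simp
  · simp [IsSelfAdjoint, h1, h2]

/-- In a simple C*-algebra an infinite projection `e` is properly infinite: there are infinitely
many isometries over `e` with mutually orthogonal ranges below `e`. -/
theorem IsInfiniteProjection.exists_isIsometryFamily (hA : IsSimpleCStar A) {e : A}
    (he : IsInfiniteProjection e) :
    ∃ s : ℕ → A, IsIsometryFamily e s ∧ ∀ i, e * s i = s i := by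
  obtain ⟨hep, e', hsub, u, hu1, hu2⟩ := he
  have hee : e * e = e := hep.isIdempotentElem
  have hd := hsub.isStarProjection_sub
  set d := e - e' with hddef
  have hds : star d = d := hd.isSelfAdjoint
  have hdd : d * d = d := hd.isIdempotentElem
  have hed : e * d = d := by rw [hddef, mul_sub, hee, hsub.mul_eq]
  set v := star u with hv
  have hvv : star v * v = e := by rw [hv, star_star, hu2]
  have hvv' : v * star v = e' := by rw [hv, star_star, hu1]
  have hve : v * e = v := mul_eq_self_of_star_mul_self hep hvv
  have hv'v : e' * v = v := by rw [← hvv', mul_assoc, hvv, hve]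
  have hev : e * v = v := by rw [← hv'v, ← mul_assoc, hsub.mul_eq]
  have hdv : d * v = 0 := by rw [hddef, sub_mul, hev, hv'v, sub_self]
  obtain ⟨n, x, hx⟩ := exists_eq_sum_conjugate hA hd (sub_ne_zero.2 hsub.ne.symm) hep
  -- Powers of `v` act by iterated multiplication, which makes sense of the zeroth power without a
  -- unit.
  let P : ℕ → A → A := fun k a => (fun b => v * b)^[k] a
  have PS : ∀ k a, P (k + 1) a = v * P k a := fun k a => Function.iterate_succ_apply' _ k a
  have Padd : ∀ k l a, P (k + l) a = P k (P l a) := fun k l a =>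
    Function.iterate_add_apply _ k l a
  have heP : ∀ k a, e * a = a → e * P k a = P k a := by
    intro k a ha
    cases k with
    | zero => exact ha
    | succ k => rw [PS, ← mul_assoc, hev]
  have hPP : ∀ k a b, e * b = b → star (P k a) * P k b = star a * b := by
    intro k a b hb
    induction k with
    | zero => rfl
    | succ k ih =>
      rw [PS, PS, star_mul, mul_assoc, ← mul_assoc (star v), hvv, heP k b hb, ih]
  have hdP : ∀ k a, star d * P (k + 1) a = 0 := by
    intro k a
    rw [PS, ← mul_assoc, hds, hdv, zero_mul]
  have hlt : ∀ i k a b, i < k → star (P i (d * a)) * P k b = 0 := by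
    intro i k a b hik
    obtain ⟨m, rfl⟩ := Nat.exists_eq_add_of_lt hik
    have heP' : e * P (m + 1) b = P (m + 1) b := by rw [PS, ← mul_assoc, hev]
    rw [add_assoc, Padd, hPP i _ _ heP', star_mul, mul_assoc, hdP, mul_zero]
  have hij : ∀ i j a b, i ≠ j → star (P i (d * a)) * P j (d * b) = 0 := by
    intro i j a b hne
    rcases lt_or_gt_of_ne hne with h | h
    · exact hlt i j a _ h
    · rw [← star_star (star _ * _), star_mul, star_star, hlt j i b _ h, star_zero]
  have hxe : ∀ a, e * (d * a) = d * a := fun a => by rw [← mul_assoc, hed]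
  -- Since `d v = 0`, the ranges of the `v ^ i d` are mutually orthogonal, so cross terms vanish and
  -- `t* t = ∑ xᵢ* d xᵢ = e`. Only the first `n` of them are used, so shifting by multiples of `n`
  -- gives orthogonal copies of `t`.
  set t : A := ∑ i : Fin n, P i (d * x i) with ht
  have het : e * t = t := by
    rw [ht, Finset.mul_sum]
    exact Finset.sum_congr rfl fun i _ => heP _ _ (hxe _)
  have htt : star t * t = e := by
    rw [ht, star_sum, Finset.sum_mul]
    conv_rhs => rw [hx]
    refine Finset.sum_congr rfl fun i _ => ?_
    rw [Finset.mul_sum, Finset.sum_eq_single i]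
    · rw [hPP _ _ _ (hxe _), star_mul, hds, mul_assoc, ← mul_assoc d, hdd, mul_assoc]
    · intro j _ hji
      exact hij _ _ _ _ fun h => hji (Fin.ext h.symm)
    · simp
  have htP : ∀ k a, star t * P (n + k) a = 0 := by
    intro k a
    rw [ht, star_sum, Finset.sum_mul]
    exact Finset.sum_eq_zero fun i _ => hlt _ _ _ _ (by omega)
  have hslt : ∀ i j, i < j → star (P (n * i) t) * P (n * j) t = 0 := by
    intro i j h
    obtain ⟨m, rfl⟩ := Nat.exists_eq_add_of_lt h
    have : n * (i + m + 1) = n * i + (n + n * m) := by ring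
    rw [this, Padd, hPP _ _ _ (heP _ _ het), htP]
  refine ⟨fun k => P (n * k) t, fun i j => ?_, fun i => heP _ _ het⟩
  rcases lt_trichotomy i j with h | rfl | h
  · rw [if_neg h.ne, hslt i j h]
  · rw [if_pos rfl, hPP _ _ _ het, htt]
  · rw [if_neg h.ne', ← star_star (star _ * _), star_mul, star_star, hslt j i h, star_zero]

/-- In a simple C*-algebra every projection is subequivalent to every infinite projection. -/
theorem IsInfiniteProjection.exists_subequiv (hA : IsSimpleCStar A) {e r : A}
    (he : IsInfiniteProjection e) (hr : IsStarProjection r) :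
    ∃ t : A, star t * t = r ∧ e * t = t := by
  obtain ⟨s, hs, hes⟩ := he.exists_isIsometryFamily hA
  have he0 : e ≠ 0 := by
    rintro rfl
    obtain ⟨_, p', hp', _⟩ := he
    exact hp'.ne (by rw [← hp'.mul_eq, zero_mul])
  obtain ⟨n, x, hx⟩ := exists_eq_sum_conjugate hA he.1 he0 hr
  -- Orthogonal ranges reduce `t* t` to `∑ xᵢ* e xᵢ`.
  refine ⟨∑ i : Fin n, s i * x i, ?_, ?_⟩
  · rw [star_sum, Finset.sum_mul]
    conv_rhs => rw [hx]
    refine Finset.sum_congr rfl fun i _ => ?_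
    rw [Finset.mul_sum, Finset.sum_eq_single i]
    · rw [star_mul, mul_assoc, ← mul_assoc (star (s i)), hs, if_pos rfl, mul_assoc]
    · intro j _ hji
      rw [star_mul, mul_assoc, ← mul_assoc (star (s i)), hs,
        if_neg fun h => hji (Fin.ext h.symm), zero_mul, mul_zero]
    · simp
  · rw [Finset.mul_sum]
    exact Finset.sum_congr rfl fun i _ => by rw [← mul_assoc, hes]

/-! ### The zero class and the Cuntz relations -/

/-- `p` splits into two orthogonal copies of itself: the Cuntz relations of `𝒪₂` over `p`. -/
def IsSelfDouble (p : A) : Prop :=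
  ∃ s t : A, star s * s = p ∧ star t * t = p ∧ star s * t = 0 ∧ s * star s + t * star t = p

/-- With `t` embedding `r` below `e = r - r'` and `g = e - t t*`, one has `e = (g + t r' t*) + t e
t*`. The first summand is equivalent to `g + t r t* = e` because `r' ∼ r`, and the second to `e`
through `t e`. -/
theorem isSelfDouble_sub_of_infinite (hA : IsSimpleCStar A) {r r' : A}
    (h : IsProperSubprojection r' r) (heq : MvNEquiv r' r) (he : IsInfiniteProjection (r - r')) :
    IsSelfDouble (r - r') := by
  obtain ⟨t, htt, het⟩ := he.exists_subequiv hA h.right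
  obtain ⟨v, hv1, hv2⟩ := heq
  have hrs : star r = r := h.right.isSelfAdjoint
  have hrr : r * r = r := h.right.isIdempotentElem
  have hrr's : star r' = r' := h.left.isSelfAdjoint
  set e := r - r' with hedef
  have hes : star e = e := he.1.isSelfAdjoint
  have hee : e * e = e := he.1.isIdempotentElem
  have htr : t * r = t := mul_eq_self_of_star_mul_self h.right htt
  have hre : r * e = e := by rw [hedef, mul_sub, hrr, h.mul_eq]
  have hvr : v * r' = v := mul_eq_self_of_star_mul_self h.left hv1
  have hvr2 : v * r = v := by
    have h5 : r' * r = r' := by simpa [hrr's, hrs] using congrArg star h.mul_eq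
    rw [← hvr, mul_assoc, h5]
  set g := e - t * star t with hg
  have hgs : star g = g := by simp [hg, hes]
  have hgt : g * t = 0 := by rw [hg, sub_mul, het, mul_assoc, htt, htr, sub_self]
  have htg : star t * g = 0 := by simpa [hgs] using congrArg star hgt
  have hgg : g * g = g := by
    have heg : e * g = g := by rw [hg, mul_sub, hee, ← mul_assoc, het]
    calc g * g = e * g - t * (star t * g) := by conv_lhs => rw [hg, sub_mul, ← hg, mul_assoc]
      _ = g := by rw [heg, htg, mul_zero, sub_zero]
  refine ⟨t * star v * star t + g, t * e, ?_, ?_, ?_, ?_⟩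
  · calc star (t * star v * star t + g) * (t * star v * star t + g)
        = t * v * (star t * t) * star v * star t + t * v * (star t * g)
          + g * t * star v * star t + g * g := by
          simp only [star_add, star_mul, star_star, hgs, add_mul, mul_add, mul_assoc]
          abel
      _ = t * ((v * r) * star v) * star t + g := by
          rw [htt, htg, hgt, hgg]; simp [mul_assoc]
      _ = e := by rw [hvr2, hv2, htr, hg]; abel
  · rw [star_mul, hes, mul_assoc, ← mul_assoc (star t), htt, hre, hee]
  · have hve : v * e = 0 := by rw [hedef, mul_sub, hvr2, hvr, sub_self]
    calc star (t * star v * star t + g) * (t * e)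
        = t * v * ((star t * t) * e) + g * t * e := by
          simp only [star_add, star_mul, star_star, hgs, add_mul, mul_assoc]
      _ = 0 := by rw [htt, hre, hgt, zero_mul, mul_assoc, hve, mul_zero, add_zero]
  · calc (t * star v * star t + g) * star (t * star v * star t + g) + t * e * star (t * e)
        = t * star v * (star t * t) * v * star t + t * star v * (star t * g)
          + g * t * v * star t + g * g + t * (e * e) * star t := by
          simp only [star_add, star_mul, star_star, hgs, hes, add_mul, mul_add, mul_assoc]
          abel
      _ = t * r' * star t + g + t * e * star t := by
          have hsv : star v * (r * v) = r' := by
            rw [← hv1]; congr 1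
            rw [← hv2, mul_assoc, hv1, hvr]
          rw [htt, htg, hgt, hgg, hee, mul_assoc t, mul_assoc (t : A) _ v, mul_assoc (star v), hsv]
          simp
      _ = t * r * star t + g := by rw [hedef, mul_sub, sub_mul]; abel
      _ = e := by rw [htr, hg]; abel

theorem IsSelfDouble.of_mvNEquiv {p e : A} (hp : IsStarProjection p) (he : IsStarProjection e)
    (h : MvNEquiv p e) (hd : IsSelfDouble e) : IsSelfDouble p := by
  obtain ⟨v, hv1, hv2⟩ := h
  obtain ⟨s, t, hs, ht, hst, hsum⟩ := hd
  have hvp : v * p = v := mul_eq_self_of_star_mul_self hp hv1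
  have hev : e * v = v := by rw [← hv2, mul_assoc, hv1, hvp]
  have hse : s * e = s := mul_eq_self_of_star_mul_self he hs
  have hte : t * e = t := mul_eq_self_of_star_mul_self he ht
  have hts : star t * s = 0 := by simpa using congrArg star hst
  have hes : e * s = s := by rw [← hsum, add_mul, mul_assoc, mul_assoc, hs, hts, hse]; simp
  have het : e * t = t := by rw [← hsum, add_mul, mul_assoc, mul_assoc, ht, hst, hte]; simp
  have key : ∀ a b : A, e * b = b →
      star (star v * a * v) * (star v * b * v) = star v * (star a * b) * v := by
    intro a b hb
    conv_rhs => rw [← hb, ← hv2]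
    simp only [star_mul, star_star, mul_assoc]
  have key' : ∀ a : A, a * e = a →
      star v * a * v * star (star v * a * v) = star v * (a * star a) * v := by
    intro a ha
    have h : a * star a = a * e * star a := by rw [ha]
    rw [h, ← hv2]
    simp only [star_mul, star_star, mul_assoc]
  refine ⟨star v * s * v, star v * t * v, ?_, ?_, ?_, ?_⟩
  · rw [key _ _ hes, hs, mul_assoc, hev, hv1]
  · rw [key _ _ het, ht, mul_assoc, hev, hv1]
  · rw [key _ _ het, hst, mul_zero, zero_mul]
  · rw [key' _ hse, key' _ hte, ← add_mul, ← mul_add, hsum, mul_assoc, hev, hv1]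

theorem RepresentsZero.isSelfDouble (hA : IsSimpleCStar A) {p : A} (h : RepresentsZero p) :
    IsSelfDouble p := by
  obtain ⟨hp, r, r', hsub, heq, he, hmk⟩ := h
  exact (isSelfDouble_sub_of_infinite hA hsub heq he).of_mvNEquiv hp.1 he.1
    (Quotient.exact hmk)

theorem IsIsometryFamily.mul_right {ι : Type*} [DecidableEq ι] {p : A} {s : ι → A}
    (hp : IsStarProjection p) (hs : IsIsometryFamily p s) (i : ι) : s i * p = s i :=
  mul_eq_self_of_star_mul_self hp (by rw [hs, if_pos rfl])

theorem IsIsometryFamily.mul_left {ι : Type*} [Fintype ι] [DecidableEq ι] {p : A} {s : ι → A}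
    (hp : IsStarProjection p) (hs : IsIsometryFamily p s) (hsum : ∑ i, s i * star (s i) = p)
    (i : ι) : p * s i = s i := by
  conv_lhs => rw [← hsum]
  rw [Finset.sum_mul, Finset.sum_eq_single i]
  · rw [mul_assoc, hs, if_pos rfl, hs.mul_right hp]
  · intro j _ hj
    rw [mul_assoc, hs, if_neg hj, mul_zero]
  · simp

theorem IsSelfDouble.exists_isIsometryFamily {p : A} (hp : IsStarProjection p)
    (h : IsSelfDouble p) (n : ℕ) :
    ∃ s : Fin (n + 1) → A, IsIsometryFamily p s ∧ ∑ i, s i * star (s i) = p := by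
  have hps : star p = p := hp.isSelfAdjoint
  have hpp : p * p = p := hp.isIdempotentElem
  induction n with
  | zero =>
    refine ⟨fun _ => p, fun i j => ?_, ?_⟩
    · rw [if_pos (by omega), hps, hpp]
    · simp [hps, hpp]
  | succ n ih =>
    obtain ⟨u, hu, husum⟩ := ih
    obtain ⟨s, t, hs, ht, hst, hsum⟩ := h
    have htp : t * p = t := mul_eq_self_of_star_mul_self hp ht
    have hts : star t * s = 0 := by simpa using congrArg star hst
    have hpu := hu.mul_left hp husum
    -- One half is kept, and the other is subdivided by the family already built.
    refine ⟨Fin.cons s fun i => t * u i, fun i j => ?_, ?_⟩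
    · refine Fin.cases ?_ (fun i => ?_) i <;> refine Fin.cases ?_ (fun j => ?_) j
      · simp [hs]
      · simp [← mul_assoc, hst, (Fin.succ_ne_zero j).symm]
      · simp [mul_assoc, hts]
      · simp only [Fin.cons_succ, star_mul, Fin.succ_inj]
        rw [mul_assoc, ← mul_assoc (star t), ht, hpu, hu]
    · rw [Fin.sum_univ_succ]
      simp only [Fin.cons_zero, Fin.cons_succ, star_mul]
      have : ∑ i, t * u i * (star (u i) * star t) = t * star t := by
        calc ∑ i, t * u i * (star (u i) * star t) = t * (∑ i, u i * star (u i)) * star t := by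
              rw [Finset.mul_sum, Finset.sum_mul]
              simp only [mul_assoc]
          _ = t * star t := by rw [husum, htp]
      rw [this, hsum]

/-! ### Diagonal elements with integral total weight -/

theorem IsFiniteSumOfProjections.add {a b : A} (ha : IsFiniteSumOfProjections a)
    (hb : IsFiniteSumOfProjections b) : IsFiniteSumOfProjections (a + b) := by
  obtain ⟨n, e, he, rfl⟩ := ha
  obtain ⟨m, f, hf, rfl⟩ := hb
  refine ⟨n + m, Fin.append e f, fun i => ?_, ?_⟩
  · refine Fin.addCases (fun i => ?_) (fun i => ?_) i
    · rw [Fin.append_left]; exact he i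
    · rw [Fin.append_right]; exact hf i
  · simp only [Fin.sum_univ_add, Fin.append_left, Fin.append_right]

theorem _root_.IsStarProjection.isFiniteSumOfProjections {e : A} (he : IsStarProjection e) :
    IsFiniteSumOfProjections e :=
  ⟨1, fun _ => e, fun _ => he, by simp⟩

section

variable {ι : Type*} [Fintype ι] [DecidableEq ι]

theorem IsIsometryFamily.star_sum_smul_mul_sum_smul {p : A} {u : ι → A}
    (hu : IsIsometryFamily p u) (c d : ι → ℂ) :
    star (∑ i, c i • u i) * ∑ i, d i • u i = (∑ i, star (c i) * d i) • p := by
  rw [star_sum, Finset.sum_mul, Finset.sum_smul]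
  refine Finset.sum_congr rfl fun i _ => ?_
  rw [Finset.mul_sum, Finset.sum_eq_single i]
  · rw [star_smul, smul_mul_smul_comm, hu, if_pos rfl]
  · intro j _ hj
    rw [star_smul, smul_mul_smul_comm, hu, if_neg hj.symm, smul_zero]
  · simp

/-- Orthogonality of the characters of `ℤ/N`. -/
theorem _root_.IsPrimitiveRoot.sum_pow_mul_star_pow {N : ℕ} [NeZero N] {ω : ℂ}
    (hω : IsPrimitiveRoot ω N) {a b : ℕ} (ha : a < N) (hb : b < N) :
    ∑ k ∈ Finset.range N, ω ^ (a * k) * star (ω ^ (b * k)) = if a = b then (N : ℂ) else 0 := by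
  have hnorm : ‖ω‖ = 1 := hω.norm'_eq_one (NeZero.ne N)
  have hωω : ω * star ω = 1 := by
    rw [Complex.star_def, Complex.mul_conj, Complex.normSq_eq_norm_sq, hnorm]; simp
  have hterm : ∀ k, ω ^ (a * k) * star (ω ^ (b * k)) = (ω ^ a * star ω ^ b) ^ k := by
    intro k; rw [star_pow, mul_pow, ← pow_mul, ← pow_mul]
  simp only [hterm]
  split_ifs with h
  · subst h
    simp only [← mul_pow, hωω, one_pow]
    simp
  · have hne : ω ^ a * star ω ^ b ≠ 1 := by
      intro h1
      refine h (hω.pow_inj ha hb ?_)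
      calc ω ^ a = ω ^ a * (ω * star ω) ^ b := by rw [hωω, one_pow, mul_one]
        _ = (ω ^ a * star ω ^ b) * ω ^ b := by rw [mul_pow]; ring
        _ = ω ^ b := by rw [h1, one_mul]
    rw [geom_sum_eq hne]
    have : (ω ^ a * star ω ^ b) ^ N = 1 := by
      rw [mul_pow, ← pow_mul, ← pow_mul, mul_comm a, mul_comm b, pow_mul, pow_mul, ← star_pow,
        hω.pow_eq_one]
      simp
    rw [this, sub_self, zero_div]

/-- A diagonal element over a family of isometries whose weights add up to an integer, at least
the number of weights, is a finite sum of projections. -/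
theorem IsIsometryFamily.isFiniteSumOfProjections {p : A} (hp : IsStarProjection p) {u : ι → A}
    (hu : IsIsometryFamily p u) {l : ι → ℝ} (hl : ∀ i, 0 ≤ l i) {N : ℕ}
    (hN : Fintype.card ι ≤ N) (hsum : ∑ i, l i = N) :
    IsFiniteSumOfProjections (∑ i, (l i : ℂ) • (u i * star (u i))) := by
  rcases Nat.eq_zero_or_pos N with rfl | hNpos
  · have : IsEmpty ι := Fintype.card_eq_zero_iff.1 (Nat.le_zero.1 hN)
    exact ⟨0, fun _ => 0, fun i => i.elim0, by simp⟩
  have : NeZero N := ⟨hNpos.ne'⟩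
  have hN0 : (N : ℝ) ≠ 0 := by exact_mod_cast hNpos.ne'
  have hω := Complex.isPrimitiveRoot_exp N hNpos.ne'
  set ω := Complex.exp (2 * Real.pi * Complex.I / N)
  have hnorm : ‖ω‖ = 1 := hω.norm'_eq_one hNpos.ne'
  let f : ι → ℕ := fun i => Fintype.equivFin ι i
  have hfN : ∀ i, f i < N := fun i => (Fintype.equivFin ι i).2.trans_le hN
  have hf : Function.Injective f := Fin.val_injective.comp (Fintype.equivFin ι).injective
  -- Each vector `c k` has norm one because the weights sum to `N`. Summing over `k` kills the
  -- off-diagonal terms: `card ι ≤ N` gives the indices distinct characters of `ℤ/N`.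
  let c : ℕ → ι → ℂ := fun k i => (√(l i / N) : ℝ) * ω ^ (f i * k)
  have hsq : ∀ i, ((√(l i / N) : ℝ) : ℂ) * (√(l i / N) : ℝ) = ((l i / N : ℝ) : ℂ) := fun i => by
    rw [← Complex.ofReal_mul, Real.mul_self_sqrt (div_nonneg (hl i) (by positivity))]
  let w : ℕ → A := fun k => ∑ i, c k i • u i
  have hw : ∀ k, star (w k) * w k = p := by
    intro k
    have h1 : ∀ i, star (c k i) * c k i = ((l i / N : ℝ) : ℂ) := by
      intro i
      have h2 : star (ω ^ (f i * k)) * ω ^ (f i * k) = 1 := by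
        rw [Complex.star_def, mul_comm, Complex.mul_conj, Complex.normSq_eq_norm_sq, norm_pow,
          hnorm]
        simp
      calc star (c k i) * c k i = ((√(l i / N) : ℝ) : ℂ) * (√(l i / N) : ℝ) *
            (star (ω ^ (f i * k)) * ω ^ (f i * k)) := by
            simp only [c, star_mul', Complex.star_def, Complex.conj_ofReal]; ring
        _ = _ := by rw [h2, mul_one, hsq]
    rw [hu.star_sum_smul_mul_sum_smul]
    simp only [h1]
    rw [← Complex.ofReal_sum, ← Finset.sum_div, hsum, div_self hN0]
    simp
  refine ⟨N, fun k => w k * star (w k), fun k => isStarProjection_mul_star hp (hw k), ?_⟩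
  rw [Fin.sum_univ_eq_sum_range (fun k => w k * star (w k))]
  have hexp : ∀ k, w k * star (w k) =
      ∑ i, ∑ j, (c k i * star (c k j)) • (u i * star (u j)) := by
    intro k
    simp only [w, star_sum, Finset.sum_mul, Finset.mul_sum, star_smul, smul_mul_smul_comm]
    exact Finset.sum_comm
  simp only [hexp]
  rw [Finset.sum_comm]
  refine Finset.sum_congr rfl fun i _ => ?_
  rw [Finset.sum_comm]
  have hcoef : ∀ j, ∑ k ∈ Finset.range N, c k i * star (c k j) =
      if i = j then (l i : ℂ) else 0 := by
    intro j
    have h1 : ∀ k, c k i * star (c k j) = ((√(l i / N) : ℝ) : ℂ) * (√(l j / N) : ℝ) *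
        (ω ^ (f i * k) * star (ω ^ (f j * k))) := by
      intro k
      simp only [c, star_mul', Complex.star_def, Complex.conj_ofReal]; ring
    simp only [h1]
    rw [← Finset.mul_sum, hω.sum_pow_mul_star_pow (hfN i) (hfN j)]
    by_cases hij : i = j
    · subst hij
      rw [if_pos rfl, if_pos rfl, hsq]
      push_cast
      exact div_mul_cancel₀ _ (by exact_mod_cast hN0)
    · rw [if_neg hij, if_neg fun h => hij (hf h), mul_zero]
  simp only [← Finset.sum_smul, hcoef, ite_smul, zero_smul]
  simp

/-- Over a projection that splits into copies of itself, the weights of a diagonal element may be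
repeated at will. -/
theorem IsIsometryFamily.isFiniteSumOfProjections_of_isSelfDouble {p : A}
    (hp : IsStarProjection p) (hd : IsSelfDouble p) {u : ι → A}
    (hu : IsIsometryFamily p u) {l : ι → ℝ} (hl : ∀ i, 0 ≤ l i) (m : ι → ℕ) {N : ℕ}
    (hN : ∑ i, (m i + 1) ≤ N) (hsum : ∑ i, ((m i : ℝ) + 1) * l i = N) :
    IsFiniteSumOfProjections (∑ i, (l i : ℂ) • (u i * star (u i))) := by
  choose t ht htsum using fun i => hd.exists_isIsometryFamily hp (m i)
  let v : (Σ i, Fin (m i + 1)) → A := fun x => u x.1 * t x.1 x.2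
  have hv : IsIsometryFamily p v := by
    rintro ⟨i, a⟩ ⟨j, b⟩
    simp only [v, star_mul]
    rw [mul_assoc, ← mul_assoc (star (u i)), hu]
    by_cases hij : i = j
    · subst hij
      rw [if_pos rfl, (ht i).mul_left hp (htsum i), ht]
      simp
    · rw [if_neg hij, zero_mul, mul_zero, if_neg]
      simp [hij]
  have hfin := hv.isFiniteSumOfProjections hp (l := fun x => l x.1) (fun x => hl x.1) (N := N)
    (by simpa using hN) (by rw [Fintype.sum_sigma]; simpa using hsum)
  rw [Fintype.sum_sigma] at hfin
  convert hfin using 2 with i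
  change _ = ∑ a, (l i : ℂ) • (v ⟨i, a⟩ * star (v ⟨i, a⟩))
  rw [← Finset.smul_sum]
  congr 1
  calc u i * star (u i) = u i * (∑ a, t i a * star (t i a)) * star (u i) := by
        rw [htsum, hu.mul_right hp]
    _ = ∑ a, v ⟨i, a⟩ * star (v ⟨i, a⟩) := by
        simp only [v, Finset.mul_sum, Finset.sum_mul, star_mul, mul_assoc]

end

/-! ### Tuning the total weight -/

/-- Parameters making a total weight integral. -/
theorem exists_integral_weight {ε β : ℝ} (hε : 0 < ε) (hβ : 0 ≤ β) :
    ∃ (k M N : ℕ) (c : ℝ), 0 ≤ c ∧ c ≤ 1 ∧ c ≤ ε ∧ k + M + 4 ≤ N ∧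
      ((k : ℝ) + 1) * (1 + ε) + (M + 1) * (ε + c) + (ε - c) + β = N := by
  -- A gap below one, divided by `M`, is then at most both `1` and `ε`.
  obtain ⟨M, hM⟩ := exists_nat_gt (max 1 (1 / ε))
  have hM1 : 1 < (M : ℝ) := (le_max_left _ _).trans_lt hM
  have hMε : 1 / ε < M := (le_max_right _ _).trans_lt hM
  have hM0 : 0 < (M : ℝ) := by linarith
  -- The surplus `k ε > M + 3` makes the total at least the number `k + M + 4` of weights.
  obtain ⟨k, hk⟩ := exists_nat_gt ((M + 3) / ε)
  rw [div_lt_iff₀ hε] at hk hMε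
  set T : ℝ := ((k : ℝ) + 1) * (1 + ε) + (M + 1) * ε + ε + β with hT
  have hT0 : (k : ℝ) + M + 4 ≤ T := by nlinarith
  have hceil := Nat.le_ceil T
  have hceil' := Nat.ceil_lt_add_one (by linarith : 0 ≤ T)
  have hfrac : (⌈T⌉₊ - T) / M ≤ 1 / M := by gcongr; linarith
  -- The net coefficient of `c` is `(M + 1) - 1 = M`, so this `c` fills the gap up to the ceiling.
  refine ⟨k, M, ⌈T⌉₊, (⌈T⌉₊ - T) / M, div_nonneg (by linarith) hM0.le,
    hfrac.trans ?_, hfrac.trans ?_, ?_, ?_⟩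
  · rw [div_le_one hM0]; exact hM1.le
  · rw [div_le_iff₀ hM0]; linarith
  · exact_mod_cast hT0.trans hceil
  · have : (M : ℝ) * ((⌈T⌉₊ - T) / M) = ⌈T⌉₊ - T := by field_simp
    linear_combination this + hT

/-- Over four orthogonal copies of a projection `p` that splits into copies of itself, the weights
`(α, α, α, β)` with `α > 1` and `β ≥ 0` give a finite sum of projections. -/
theorem IsIsometryFamily.isFiniteSumOfProjections_three_one {p : A} (hp : IsStarProjection p)
    (hd : IsSelfDouble p) {u : Fin 4 → A} (hu : IsIsometryFamily p u) {α β : ℝ} (hα : 1 < α)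
    (hβ : 0 ≤ β) :
    IsFiniteSumOfProjections ((α : ℂ) • (u 0 * star (u 0) + u 1 * star (u 1) + u 2 * star (u 2)) +
      (β : ℂ) • (u 3 * star (u 3))) := by
  obtain ⟨ε, rfl⟩ : ∃ ε, α = 1 + ε := ⟨α - 1, by ring⟩
  have hε : 0 < ε := by linarith
  obtain ⟨k, M, N, c, hc0, hc1, hcε, hkN, hN⟩ := exists_integral_weight hε hβ
  -- `C = cos θ`, `S = sin θ`, `c = cos 2θ`. In the plane of `u 1, u 2`, `z` is at angle `2θ` from
  -- `u 1`, `y` bisects them and `x` is perpendicular to `y`. Thus `u 1 (u 1)* + z z*` has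
  -- eigenvalue `1 + c` along `y` and `1 - c` along `x`.
  obtain ⟨C, S, hCS, hc⟩ : ∃ C S : ℝ, C * C + S * S = 1 ∧ c = C * C - S * S := by
    refine ⟨√((1 + c) / 2), √((1 - c) / 2), ?_, ?_⟩ <;>
    · rw [Real.mul_self_sqrt (by linarith), Real.mul_self_sqrt (by linarith)]
      ring
  have hCS' : (C : ℂ) * C + S * S = 1 := by exact_mod_cast hCS
  have hc' : (c : ℂ) = C * C - S * S := by exact_mod_cast hc
  have huu : ∀ i, star (u i) * u i = p := fun i => by rw [hu, if_pos rfl]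
  have hu0 : ∀ i j, i ≠ j → star (u i) * u j = 0 := fun i j h => by rw [hu, if_neg h]
  obtain ⟨x, hx⟩ : ∃ x : A, x = -(S : ℂ) • u 1 + (C : ℂ) • u 2 := ⟨_, rfl⟩
  obtain ⟨y, hy⟩ : ∃ y : A, y = (C : ℂ) • u 1 + (S : ℂ) • u 2 := ⟨_, rfl⟩
  obtain ⟨z, hz⟩ : ∃ z : A, z = (c : ℂ) • u 1 + (2 * C * S : ℂ) • u 2 := ⟨_, rfl⟩
  have hxx : star x * x = p := by
    simp only [hx, star_add, star_smul, star_neg, add_mul, mul_add, smul_mul_smul_comm, huu,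
      hu0 1 2 (by decide), hu0 2 1 (by decide), Complex.star_def, Complex.conj_ofReal, smul_zero,
      add_zero, zero_add, ← add_smul]
    rw [show -(S : ℂ) * -S + C * C = 1 by linear_combination hCS', one_smul]
  have hyy : star y * y = p := by
    simp only [hy, star_add, star_smul, add_mul, mul_add, smul_mul_smul_comm, huu,
      hu0 1 2 (by decide), hu0 2 1 (by decide), Complex.star_def, Complex.conj_ofReal, smul_zero,
      add_zero, zero_add, ← add_smul]
    rw [hCS', one_smul]
  have hzz : star z * z = p := by
    simp only [hz, star_add, star_smul, add_mul, mul_add, smul_mul_smul_comm, huu,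
      hu0 1 2 (by decide), hu0 2 1 (by decide), Complex.star_def, Complex.conj_ofReal, smul_zero,
      add_zero, zero_add, ← add_smul, map_mul, map_ofNat]
    rw [show (c : ℂ) * c + 2 * C * S * (2 * C * S) = 1 by
      rw [hc']; linear_combination (C * C + S * S + 1 : ℂ) * hCS', one_smul]
  have hxy : star x * y = 0 := by
    simp only [hx, hy, star_add, star_smul, star_neg, add_mul, mul_add, smul_mul_smul_comm, huu,
      hu0 1 2 (by decide), hu0 2 1 (by decide), Complex.star_def, Complex.conj_ofReal, smul_zero,
      add_zero, zero_add, ← add_smul]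
    rw [show -(S : ℂ) * C + C * S = 0 by ring, zero_smul]
  have hyx : star y * x = 0 := by simpa using congrArg star hxy
  have horth : ∀ i, i ≠ 1 → i ≠ 2 → ∀ a b : ℂ, star (u i) * (a • u 1 + b • u 2) = 0 := by
    intro i h1 h2 a b
    rw [mul_add, mul_smul_comm, mul_smul_comm, hu0 _ _ h1, hu0 _ _ h2]
    simp
  have hux0 : star (u 0) * x = 0 := hx ▸ horth 0 (by decide) (by decide) _ _
  have huy0 : star (u 0) * y = 0 := hy ▸ horth 0 (by decide) (by decide) _ _
  have hux3 : star (u 3) * x = 0 := hx ▸ horth 3 (by decide) (by decide) _ _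
  have huy3 : star (u 3) * y = 0 := hy ▸ horth 3 (by decide) (by decide) _ _
  have hfam : IsIsometryFamily p ![u 0, x, y, u 3] := by
    have hstar : ∀ {a b : A}, star a * b = 0 → star b * a = 0 := fun h => by
      simpa using congrArg star h
    intro i j
    fin_cases i <;> fin_cases j <;>
      simp [huu, hxx, hyy, hxy, hyx, hu0 0 3 (by decide), hu0 3 0 (by decide), hux0, huy0, hux3,
        huy3, hstar hux0, hstar huy0, hstar hux3, hstar huy3, -star_add, -star_smul]
  -- The entries of `![k, M, 0, 0]` are multiplicities minus one.
  have hdiag := hfam.isFiniteSumOfProjections_of_isSelfDouble hp hd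
    (l := ![1 + ε, ε + c, ε - c, β])
    (by intro i; fin_cases i <;> simp <;> linarith) ![k, M, 0, 0] (N := N)
    (by simp [Fin.sum_univ_four]; omega)
    (by simp [Fin.sum_univ_four]; linarith)
  have htotal := ((isStarProjection_mul_star hp (huu 1)).isFiniteSumOfProjections.add
    (isStarProjection_mul_star hp hzz).isFiniteSumOfProjections).add hdiag
  convert htotal using 1
  simp only [Fin.sum_univ_four, Matrix.cons_val, hx, hy, hz, star_add, star_smul, star_neg, mul_add,
    add_mul, smul_mul_smul_comm, Complex.star_def, Complex.conj_ofReal, map_mul, map_ofNat]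
  rw [hc']
  push_cast
  rw [hc']
  match_scalars
  all_goals
    first
    | ring1
    | linear_combination (-(ε : ℂ)) * hCS'
    | linear_combination (-(ε : ℂ) - (C * C + S * S + 1)) * hCS'

end CStarK0

/-! ### The two statements -/

theorem propositionP {A : Type*} [NonUnitalCStarAlgebra A]
    (hsimple : CStarK0.IsSimpleCStar A) (hinf : CStarK0.IsInfiniteCStar A) :
    (∀ p q : A, CStarK0.RepresentsZero p → CStarK0.RepresentsZero q →
      p * q = 0 → CStarK0.MvNEquiv p q →
      ∀ α β : ℝ, 1 < α → 0 ≤ β →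
        CStarK0.IsFiniteSumOfProjections ((α : ℂ) • p + (β : ℂ) • q)) ∧
    (∀ p : A, CStarK0.RepresentsZero p →
      ∀ α : ℝ, 1 < α → CStarK0.IsFiniteSumOfProjections ((α : ℂ) • p)) := by
  refine ⟨fun p q hp hq hpq heq α β hα hβ => ?_, fun p hp α hα => ?_⟩
  · have hpp : IsStarProjection p := hp.1.1
    have hd := hp.isSelfDouble hsimple
    obtain ⟨v, hv1, hv2⟩ := heq
    -- Three copies of `p` exhaust `p` and carry `α`; `v` supplies the fourth, with range `q`.
    obtain ⟨s, hs, hsum⟩ := hd.exists_isIsometryFamily hpp 2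
    have hps := hs.mul_left hpp hsum
    have hsp : ∀ i, star (s i) * p = star (s i) := fun i => by
      simpa [hpp.isSelfAdjoint.star_eq] using congrArg star (hps i)
    have hvp : v * p = v := CStarK0.mul_eq_self_of_star_mul_self hpp hv1
    have hpv : p * v = 0 := by
      have : v = q * v := by rw [← hv2, mul_assoc, hv1, hvp]
      rw [this, ← mul_assoc, hpq, zero_mul]
    have hsv : ∀ i, star (s i) * v = 0 := fun i => by
      rw [← hsp, mul_assoc, hpv, mul_zero]
    have hvs : ∀ i, star v * s i = 0 := fun i => by simpa using congrArg star (hsv i)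
    have hfam : CStarK0.IsIsometryFamily p ![s 0, s 1, s 2, v] := by
      intro i j
      fin_cases i <;> fin_cases j <;> simp [hs _ _, hsv, hvs, hv1]
    have h := hfam.isFiniteSumOfProjections_three_one hpp hd hα hβ
    rw [Fin.sum_univ_three] at hsum
    simpa [hsum, hv2] using h
  · have hpp : IsStarProjection p := hp.1.1
    have hd := hp.isSelfDouble hsimple
    -- Here all four copies lie in `p`, and `β = α`.
    obtain ⟨s, hs, hsum⟩ := hd.exists_isIsometryFamily hpp 3
    have h := hs.isFiniteSumOfProjections_three_one hpp hd hα (zero_le_one.trans hα.le)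
    rwa [← smul_add, ← Fin.sum_univ_four (fun i => s i * star (s i)), hsum] at h
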